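/- Let $H_1,H_2$ be complex Hilbert spaces and let $\rho$ be a density operator (a positive trace-class operator of trace one) on the Hilbert space tensor product $H_1\otimes H_2$. Call a self-adjoint trace-class operator $T_{122}$ on $H_1\otimes H_2\otimes H_2$ a source-operator for $\rho$ if its partial trace over the second tensor factor and its partial trace over the third tensor factor both equal $\rho$. Call a self-adjoint trace-class operator $T_{112}$ on $H_1\otimes H_1\otimes H_2$ a source-operator for $\rho$ if its partial trace over the first tensor factor and its partial trace over the second tensor factor both equal $\rho$. Then source-operators $T_{122}$ and $T_{112}$ for $\rho$ exist. Moreover, they can be given explicitly as follows. (a) Let $\{\varphi_n\}$ be an orthonormal basis of $H_2$, let $\rho_{nm}$ be the bounded operators on $H_1$ with $\langle x,\rho_{nm}x'\rangle=\langle x\otimes\varphi_n,\rho\,(x'\otimes\varphi_m)\rangle$ for all $x,x'\in H_1$, let $\sigma$ be any density operator on $H_2$, and let $\tau$ be any self-adjoint trace-class operator on $H_1\otimes H_2\otimes H_2$ whose partial traces over the second and over the third factor both vanish. Then $\rho=\sum_{n,m}\rho_{nm}\otimes|\varphi_n\rangle\langle\varphi_m|$, and $$T_{122}=\sum_{n,m}\rho_{nm}\otimes|\varphi_n\rangle\langle\varphi_m|\otimes\sigma+\sum_{n,m}\rho_{nm}\otimes\sigma\otimes|\varphi_n\rangle\langle\varphi_m|-\mathrm{tr}_{H_2}[\rho]\otimes\sigma\otimes\sigma+\tau$$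 is a source-operator for $\rho$. (b) Let $\{e_n\}$ be an orthonormal basis of $H_1$, let $\rho'_{nm}$ be the bounded operators on $H_2$ with $\langle y,\rho'_{nm}y'\rangle=\langle e_n\otimes y,\rho\,(e_m\otimes y')\rangle$ for all $y,y'\in H_2$, let $\sigma$ be any density operator on $H_1$, and let $\tau$ be any self-adjoint trace-class operator on $H_1\otimes H_1\otimes H_2$ whose partial traces over the first and over the second factor both vanish. Then $\rho=\sum_{n,m}|e_n\rangle\langle e_m|\otimes\rho'_{nm}$, and $$T_{112}=\sum_{n,m}\sigma\otimes|e_n\rangle\langle e_m|\otimes\rho'_{nm}+\sum_{n,m}|e_n\rangle\langle e_m|\otimes\sigma\otimes\rho'_{nm}-\sigma\otimes\sigma\otimes\mathrm{tr}_{H_1}[\rho]+\tau$$ is a source-operator for $\rho$. All the series converge unconditionally in operator norm, and the partial traces $\mathrm{tr}_{H_2}[\rho]$ and $\mathrm{tr}_{H_1}[\rho]$ exist. -/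

import Mathlib

open scoped TensorProduct InnerProductSpace

universe u v w u₁ u₂

/-- The Hilbert space tensor product: the completion of the algebraic tensor product with respect to
the inner product `⟪x ⊗ y, x' ⊗ y'⟫ = ⟪x, x'⟫ * ⟪y, y'⟫`. -/
abbrev HilbertTensor (E : Type u) (F : Type v) [NormedAddCommGroup E] [InnerProductSpace ℂ E]
    [NormedAddCommGroup F] [InnerProductSpace ℂ F] : Type (max u v) :=
  UniformSpace.Completion (E ⊗[ℂ] F)

noncomputable section

section Tensors

variable {E : Type u} {F : Type v} [NormedAddCommGroup E] [InnerProductSpace ℂ E]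
  [NormedAddCommGroup F] [InnerProductSpace ℂ F]

/-- The product vector `x ⊗ y` of the Hilbert space tensor product. -/
def hTmul (x : E) (y : F) : HilbertTensor E F := ((x ⊗ₜ[ℂ] y : E ⊗[ℂ] F) : HilbertTensor E F)

/-- The bounded map `x ↦ x ⊗ y`. -/
def tensorRight (E : Type u) [NormedAddCommGroup E] [InnerProductSpace ℂ E] (y : F) :
    E →L[ℂ] HilbertTensor E F :=
  UniformSpace.Completion.toComplL ∘L (TensorProduct.mkL ℂ E F).flip y

/-- The bounded map `y ↦ x ⊗ y`. -/
def tensorLeft (F : Type v) [NormedAddCommGroup F] [InnerProductSpace ℂ F] (x : E) :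
    F →L[ℂ] HilbertTensor E F :=
  UniformSpace.Completion.toComplL ∘L TensorProduct.mkL ℂ E F x

/-- The bounded operator `A ⊗ B` on the Hilbert space tensor product. -/
def opTensor (A : E →L[ℂ] E) (B : F →L[ℂ] F) : HilbertTensor E F →L[ℂ] HilbertTensor E F :=
  (TensorProduct.mapL A B).completion

end Tensors

section TraceClass

variable {E : Type u} [NormedAddCommGroup E] [InnerProductSpace ℂ E]

/-- `T` is trace class: `∑ᵢ ⟪bᵢ, |T| bᵢ⟫ < ∞` for every orthonormal basis `b`,
where `|T| = (T* T)^{1/2}`. -/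
def IsTraceClass [CompleteSpace E] (T : E →L[ℂ] E) : Prop :=
  ∀ (ι : Type u) (b : HilbertBasis ι ℂ E), Summable fun i => (⟪b i, CFC.abs T (b i)⟫_ℂ).re

/-- `T` has trace `t`: `∑ᵢ ⟪bᵢ, T bᵢ⟫ = t` for every orthonormal basis `b`. -/
def HasTrace (T : E →L[ℂ] E) (t : ℂ) : Prop :=
  ∀ (ι : Type u) (b : HilbertBasis ι ℂ E), HasSum (fun i => ⟪b i, T (b i)⟫_ℂ) t

/-- Density operators (normal quantum states): positive trace class operators of trace one. -/
structure IsDensityOperator [CompleteSpace E] (ρ : E →L[ℂ] E) : Prop where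
  isPositive : ρ.IsPositive
  isTraceClass : IsTraceClass ρ
  hasTrace_one : HasTrace ρ 1

end TraceClass

section PartialTraceTwo

variable {E : Type u} {F : Type v} [NormedAddCommGroup E] [InnerProductSpace ℂ E]
  [NormedAddCommGroup F] [InnerProductSpace ℂ F]

/-- `S` is the partial trace over `F` of the operator `T` on `E ⊗ F`. -/
def IsPartialTraceRight (T : HilbertTensor E F →L[ℂ] HilbertTensor E F) (S : E →L[ℂ] E) : Prop :=
  ∀ (ι : Type v) (b : HilbertBasis ι ℂ F) (x x' : E),
    HasSum (fun i => ⟪hTmul x (b i), T (hTmul x' (b i))⟫_ℂ) ⟪x, S x'⟫_ℂ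

/-- `S` is the partial trace over `E` of the operator `T` on `E ⊗ F`. -/
def IsPartialTraceLeft (T : HilbertTensor E F →L[ℂ] HilbertTensor E F) (S : F →L[ℂ] F) : Prop :=
  ∀ (ι : Type u) (b : HilbertBasis ι ℂ E) (y y' : F),
    HasSum (fun i => ⟪hTmul (b i) y, T (hTmul (b i) y')⟫_ℂ) ⟪y, S y'⟫_ℂ

end PartialTraceTwo

section PartialTraceThree

/-! Partial traces of operators on `E ⊗ F ⊗ G`. A bounded operator is determined by its matrix
elements between product vectors, since these span a dense subspace. -/

variable {E : Type u} {F : Type v} {G : Type w} [NormedAddCommGroup E] [InnerProductSpace ℂ E]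
  [NormedAddCommGroup F] [InnerProductSpace ℂ F] [NormedAddCommGroup G] [InnerProductSpace ℂ G]

/-- `S` is the partial trace of `T` over the space in the first place. -/
def IsPartialTraceFirst
    (T : HilbertTensor (HilbertTensor E F) G →L[ℂ] HilbertTensor (HilbertTensor E F) G)
    (S : HilbertTensor F G →L[ℂ] HilbertTensor F G) : Prop :=
  ∀ (ι : Type u) (b : HilbertBasis ι ℂ E) (y y' : F) (z z' : G),
    HasSum (fun i => ⟪hTmul (hTmul (b i) y) z, T (hTmul (hTmul (b i) y') z')⟫_ℂ)
      ⟪hTmul y z, S (hTmul y' z')⟫_ℂ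

/-- `S` is the partial trace of `T` over the space in the second place. -/
def IsPartialTraceSecond
    (T : HilbertTensor (HilbertTensor E F) G →L[ℂ] HilbertTensor (HilbertTensor E F) G)
    (S : HilbertTensor E G →L[ℂ] HilbertTensor E G) : Prop :=
  ∀ (ι : Type v) (b : HilbertBasis ι ℂ F) (x x' : E) (z z' : G),
    HasSum (fun i => ⟪hTmul (hTmul x (b i)) z, T (hTmul (hTmul x' (b i)) z')⟫_ℂ)
      ⟪hTmul x z, S (hTmul x' z')⟫_ℂ

/-- `S` is the partial trace of `T` over the space in the third place. -/
def IsPartialTraceThird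
    (T : HilbertTensor (HilbertTensor E F) G →L[ℂ] HilbertTensor (HilbertTensor E F) G)
    (S : HilbertTensor E F →L[ℂ] HilbertTensor E F) : Prop :=
  ∀ (ι : Type w) (b : HilbertBasis ι ℂ G) (x x' : E) (y y' : F),
    HasSum (fun i => ⟪hTmul (hTmul x y) (b i), T (hTmul (hTmul x' y') (b i))⟫_ℂ)
      ⟪hTmul x y, S (hTmul x' y')⟫_ℂ

end PartialTraceThree

section SourceOperators

variable {H₁ : Type u₁} {H₂ : Type u₂} [NormedAddCommGroup H₁] [InnerProductSpace ℂ H₁]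
  [NormedAddCommGroup H₂] [InnerProductSpace ℂ H₂]

/-- `T` on `H₁ ⊗ H₂ ⊗ H₂` is a source-operator for `ρ` on `H₁ ⊗ H₂`. -/
structure IsSourceOperator₁₂₂ (ρ : HilbertTensor H₁ H₂ →L[ℂ] HilbertTensor H₁ H₂)
    (T : HilbertTensor (HilbertTensor H₁ H₂) H₂ →L[ℂ] HilbertTensor (HilbertTensor H₁ H₂) H₂) :
    Prop where
  isSelfAdjoint : IsSelfAdjoint T
  isTraceClass : IsTraceClass T
  partialTrace_second : IsPartialTraceSecond T ρ
  partialTrace_third : IsPartialTraceThird T ρ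

/-- `T` on `H₁ ⊗ H₁ ⊗ H₂` is a source-operator for `ρ` on `H₁ ⊗ H₂`. -/
structure IsSourceOperator₁₁₂ (ρ : HilbertTensor H₁ H₂ →L[ℂ] HilbertTensor H₁ H₂)
    (T : HilbertTensor (HilbertTensor H₁ H₁) H₂ →L[ℂ] HilbertTensor (HilbertTensor H₁ H₁) H₂) :
    Prop where
  isSelfAdjoint : IsSelfAdjoint T
  isTraceClass : IsTraceClass T
  partialTrace_first : IsPartialTraceFirst T ρ
  partialTrace_second : IsPartialTraceSecond T ρ

/-- The block `A` on `H₁` of `ρ` with `⟪x, A x'⟫ = ⟪x ⊗ f, ρ (x' ⊗ f')⟫`. -/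
def blockRight [CompleteSpace H₁] (ρ : HilbertTensor H₁ H₂ →L[ℂ] HilbertTensor H₁ H₂)
    (f f' : H₂) : H₁ →L[ℂ] H₁ :=
  ContinuousLinearMap.adjoint (tensorRight H₁ f) ∘L ρ ∘L tensorRight H₁ f'

/-- The block `A` on `H₂` of `ρ` with `⟪y, A y'⟫ = ⟪e ⊗ y, ρ (e' ⊗ y')⟫`. -/
def blockLeft [CompleteSpace H₂] (ρ : HilbertTensor H₁ H₂ →L[ℂ] HilbertTensor H₁ H₂)
    (e e' : H₁) : H₂ →L[ℂ] H₂ :=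
  ContinuousLinearMap.adjoint (tensorLeft H₂ e) ∘L ρ ∘L tensorLeft H₂ e'

/-- The operator `|x⟩⟨y|`, that is, `z ↦ ⟪y, z⟫ x`. -/
def ketBra {H : Type u} [NormedAddCommGroup H] [InnerProductSpace ℂ H] (x y : H) : H →L[ℂ] H :=
  InnerProductSpace.rankOne ℂ x y

end SourceOperators

end

/-! The construction is an inclusion-exclusion. On H₁ ⊗ H₂ ⊗ H₂ let A be ρ ⊗ σ, let B be A with the
last two factors exchanged, and let r be the partial trace of ρ over H₂. Since σ has trace one,
tracing out either copy of H₂ turns one of A, B into ρ and the other into r ⊗ σ. The partial trace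
of r ⊗ σ ⊗ σ is r ⊗ σ as well, so subtracting it leaves ρ, and τ contributes nothing.
Source-operators need not be positive, so the subtraction is harmless. The case H₁ ⊗ H₁ ⊗ H₂ uses
other permutations of the factors.

The analysis rests on Hilbert-Schmidt operators: a positive operator is trace class exactly when its
square root is Hilbert-Schmidt, and the sum `hsSq` does not depend on the basis. Hence positive
trace class operators are stable under tensor products, unitary conjugation and partial traces, and
`isTraceClass_sub` passes to differences of them. For the series, `hasSum_blocks` expands ρ in
operator norm; the series for A and B are its images under the bounded linear maps `opTensorFlip`
and `unitaryConj`. -/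

section

open ContinuousLinearMap UniformSpace

/-! ### Product vectors and product bases -/

section ProductVectors

variable {E : Type*} {F : Type*} [NormedAddCommGroup E] [InnerProductSpace ℂ E]
  [NormedAddCommGroup F] [InnerProductSpace ℂ F]

@[simp]
theorem tensorRight_apply (x : E) (y : F) : tensorRight E y x = hTmul x y := rfl

@[simp]
theorem tensorLeft_apply (x : E) (y : F) : tensorLeft F x y = hTmul x y := rfl

@[simp]
theorem inner_hTmul (x x' : E) (y y' : F) :
    ⟪hTmul x y, hTmul x' y'⟫_ℂ = ⟪x, x'⟫_ℂ * ⟪y, y'⟫_ℂ := by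
  simp [hTmul]

@[simp]
theorem opTensor_hTmul (A : E →L[ℂ] E) (B : F →L[ℂ] F) (x : E) (y : F) :
    opTensor A B (hTmul x y) = hTmul (A x) (B y) := by
  simp [opTensor, hTmul, ContinuousLinearMap.completion_apply_coe]

theorem hTmul_ext {M : Type*} [NormedAddCommGroup M] [NormedSpace ℂ M]
    {f g : HilbertTensor E F →L[ℂ] M} (h : ∀ x y, f (hTmul x y) = g (hTmul x y)) : f = g := by
  ext v
  induction v using Completion.induction_on with
  | hp => exact isClosed_eq f.continuous g.continuous
  | ih a =>
    induction a with
    | zero => rw [Completion.coe_zero, map_zero, map_zero]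
    | tmul x y => exact h x y
    | add a b ha hb => rw [Completion.coe_add, map_add, map_add, ha, hb]

/-- Used to pass from basis vectors to arbitrary vectors one tensor factor at a time. -/
theorem HilbertBasis.clm_apply_eq {ι : Type*} (b : HilbertBasis ι ℂ E) {M : Type*}
    [NormedAddCommGroup M] [NormedSpace ℂ M] (f g : E →L[ℂ] M) (h : ∀ i, f (b i) = g (b i))
    (x : E) : f x = g x := by
  refine congrArg (fun k : E →L[ℂ] M ↦ k x) (ContinuousLinearMap.ext_on
    (Submodule.dense_iff_topologicalClosure_eq_top.2 b.dense_span) ?_)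
  rintro _ ⟨i, rfl⟩
  exact h i

theorem norm_opTensor_le (A : E →L[ℂ] E) (B : F →L[ℂ] F) : ‖opTensor A B‖ ≤ ‖A‖ * ‖B‖ := by
  refine opNorm_le_bound _ (by positivity) fun v ↦ ?_
  induction v using Completion.induction_on with
  | hp => exact isClosed_le (by fun_prop) (by fun_prop)
  | ih a =>
    rw [opTensor, ContinuousLinearMap.completion_apply_coe, Completion.norm_coe,
      Completion.norm_coe]
    exact (TensorProduct.mapL A B).le_of_opNorm_le (TensorProduct.norm_mapL_le A B) a

theorem hTmul_add_left (x x' : E) (y : F) : hTmul (x + x') y = hTmul x y + hTmul x' y :=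
  (tensorRight E y).map_add x x'

theorem hTmul_smul_left (x : E) (c : ℂ) (y : F) : hTmul (c • x) y = c • hTmul x y :=
  (tensorRight E y).map_smul c x

/-- The continuous linear map `A ↦ A ⊗ B`. -/
noncomputable def opTensorFlip (E : Type*) [NormedAddCommGroup E] [InnerProductSpace ℂ E]
    (B : F →L[ℂ] F) :
    (E →L[ℂ] E) →L[ℂ] (HilbertTensor E F →L[ℂ] HilbertTensor E F) :=
  LinearMap.mkContinuous
    { toFun := fun A ↦ opTensor A B
      map_add' := fun A A' ↦ hTmul_ext fun x y ↦ by simp [hTmul_add_left]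
      map_smul' := fun c A ↦ hTmul_ext fun x y ↦ by simp [hTmul_smul_left] }
    ‖B‖ fun A ↦ (norm_opTensor_le A B).trans_eq (mul_comm _ _)

@[simp]
theorem opTensorFlip_apply (A : E →L[ℂ] E) (B : F →L[ℂ] F) : opTensorFlip E B A = opTensor A B :=
  rfl

theorem opTensor_comp (A A' : E →L[ℂ] E) (B B' : F →L[ℂ] F) :
    opTensor (A ∘L A') (B ∘L B') = opTensor A B ∘L opTensor A' B' :=
  hTmul_ext fun x y ↦ by simp

theorem adjoint_opTensor [CompleteSpace E] [CompleteSpace F] (A : E →L[ℂ] E) (B : F →L[ℂ] F) :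
    adjoint (opTensor A B) = opTensor (adjoint A) (adjoint B) := by
  refine hTmul_ext fun x y ↦ ?_
  refine ext_inner_left ℂ fun v ↦ ?_
  rw [adjoint_inner_right]
  have : (innerSL ℂ (hTmul x y)) ∘L opTensor A B
      = innerSL ℂ (opTensor (adjoint A) (adjoint B) (hTmul x y)) :=
    hTmul_ext fun x' y' ↦ by simp [adjoint_inner_left]
  rw [← inner_conj_symm, ← inner_conj_symm v]
  exact congrArg _ (congrArg (fun f ↦ f v) this)

/-- The product of two Hilbert bases is a Hilbert basis of the Hilbert space tensor product. -/
noncomputable def HilbertBasis.hTmul {ι κ : Type*} (b : HilbertBasis ι ℂ E)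
    (c : HilbertBasis κ ℂ F) : HilbertBasis (ι × κ) ℂ (HilbertTensor E F) :=
  HilbertBasis.mkOfOrthogonalEqBot (v := fun p : ι × κ ↦ _root_.hTmul (b p.1) (c p.2))
    (by
      classical
      rw [orthonormal_iff_ite]
      rintro ⟨i, j⟩ ⟨i', j'⟩
      simp only [inner_hTmul, orthonormal_iff_ite.1 b.orthonormal,
        orthonormal_iff_ite.1 c.orthonormal, Prod.mk.injEq]
      split_ifs <;> simp_all)
    (by
      rw [eq_bot_iff]
      intro v hv
      have h0 : ∀ i j, ⟪v, _root_.hTmul (b i) (c j)⟫_ℂ = 0 := fun i j ↦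
        (Submodule.mem_orthogonal' _ _).1 hv _ (Submodule.subset_span ⟨(i, j), rfl⟩)
      -- A vector orthogonal to all products of basis vectors is orthogonal to all product vectors,
      -- freeing one factor at a time, hence is zero.
      have h1 : ∀ x j, ⟪v, _root_.hTmul x (c j)⟫_ℂ = 0 := fun x j ↦ by
        simpa using b.clm_apply_eq (innerSL ℂ v ∘L tensorRight E (c j)) 0 (fun i ↦ by simp [h0]) x
      have h2 : ∀ x y, ⟪v, _root_.hTmul x y⟫_ℂ = 0 := fun x y ↦ by
        simpa using c.clm_apply_eq (innerSL ℂ v ∘L tensorLeft F x) 0 (fun i ↦ by simp [h1]) y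
      have h3 : innerSL ℂ v = 0 := hTmul_ext fun x y ↦ by simp [h2]
      simpa using congrArg (fun f : HilbertTensor E F →L[ℂ] ℂ ↦ f v) h3)

@[simp]
theorem HilbertBasis.hTmul_apply {ι κ : Type*} (b : HilbertBasis ι ℂ E)
    (c : HilbertBasis κ ℂ F) (p : ι × κ) : b.hTmul c p = _root_.hTmul (b p.1) (c p.2) := by
  simp [HilbertBasis.hTmul]

end ProductVectors

/-! ### Unitaries permuting tensor factors -/

section Rearrangement

variable {E F G : Type*} [NormedAddCommGroup E] [InnerProductSpace ℂ E]
  [NormedAddCommGroup F] [InnerProductSpace ℂ F] [NormedAddCommGroup G] [InnerProductSpace ℂ G]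

variable [CompleteSpace F]

theorem HilbertBasis.exists_linearIsometryEquiv {ι κ : Type*} (b : HilbertBasis ι ℂ E)
    (c : HilbertBasis κ ℂ F) (e : ι ≃ κ) : ∃ U : E ≃ₗᵢ[ℂ] F, ∀ i, U (b i) = c (e i) := by
  classical
  let c' : HilbertBasis ι ℂ F := HilbertBasis.mk (v := c ∘ e)
    (c.orthonormal.comp e e.injective) (by
      rw [e.surjective.range_comp]
      exact c.dense_span.ge)
  refine ⟨b.repr.trans c'.repr.symm, fun i ↦ ?_⟩
  simp [c', HilbertBasis.repr_self, HilbertBasis.repr_symm_single]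

variable [CompleteSpace E] [CompleteSpace G]

/-- The unitary is prescribed by a bijection of product bases; continuity and linearity in each
factor then give the formula on all product vectors. The two permutations of three factors below
arise in the same way. -/
theorem exists_comm_hTmul : ∃ U : HilbertTensor E F ≃ₗᵢ[ℂ] HilbertTensor F E,
    ∀ x y, U (hTmul x y) = hTmul y x := by
  obtain ⟨_, b, -⟩ := exists_hilbertBasis ℂ E
  obtain ⟨_, c, -⟩ := exists_hilbertBasis ℂ F
  obtain ⟨U, hU⟩ := (b.hTmul c).exists_linearIsometryEquiv (c.hTmul b) (Equiv.prodComm _ _)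
  have h0 : ∀ i j, U (hTmul (b i) (c j)) = hTmul (c j) (b i) := fun i j ↦ by simpa using hU (i, j)
  have h1 : ∀ x j, U (hTmul x (c j)) = hTmul (c j) x := fun x j ↦ by
    simpa using b.clm_apply_eq
        (U.toContinuousLinearEquiv.toContinuousLinearMap ∘L tensorRight E (c j))
        (tensorLeft E (c j)) (fun i ↦ by simp [h0]) x
  exact ⟨U, fun x y ↦ by
    simpa using c.clm_apply_eq
        (U.toContinuousLinearEquiv.toContinuousLinearMap ∘L tensorLeft F x)
        (tensorRight F x) (fun i ↦ by simp [h1]) y⟩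

theorem exists_swap_hTmul :
    ∃ U : HilbertTensor (HilbertTensor E F) G ≃ₗᵢ[ℂ] HilbertTensor (HilbertTensor E G) F,
    ∀ x y z, U (hTmul (hTmul x y) z) = hTmul (hTmul x z) y := by
  obtain ⟨_, b, -⟩ := exists_hilbertBasis ℂ E
  obtain ⟨_, c, -⟩ := exists_hilbertBasis ℂ F
  obtain ⟨_, d, -⟩ := exists_hilbertBasis ℂ G
  obtain ⟨U, hU⟩ := ((b.hTmul c).hTmul d).exists_linearIsometryEquiv ((b.hTmul d).hTmul c)
    ⟨fun p ↦ ((p.1.1, p.2), p.1.2), fun p ↦ ((p.1.1, p.2), p.1.2), fun _ ↦ rfl, fun _ ↦ rfl⟩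
  have h0 : ∀ i j k, U (hTmul (hTmul (b i) (c j)) (d k)) = hTmul (hTmul (b i) (d k)) (c j) :=
    fun i j k ↦ by simpa using hU ((i, j), k)
  have h1 : ∀ x j k, U (hTmul (hTmul x (c j)) (d k)) = hTmul (hTmul x (d k)) (c j) :=
    fun x j k ↦ by
      simpa using b.clm_apply_eq
        (U.toContinuousLinearEquiv.toContinuousLinearMap ∘L tensorRight _ (d k) ∘L
          tensorRight E (c j))
        (tensorRight _ (c j) ∘L tensorRight E (d k)) (fun i ↦ by simp [h0]) x
  have h2 : ∀ x y k, U (hTmul (hTmul x y) (d k)) = hTmul (hTmul x (d k)) y :=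
    fun x y k ↦ by
      simpa using c.clm_apply_eq
        (U.toContinuousLinearEquiv.toContinuousLinearMap ∘L tensorRight _ (d k) ∘L tensorLeft F x)
        (tensorLeft F (hTmul x (d k))) (fun i ↦ by simp [h1]) y
  exact ⟨U, fun x y z ↦ by
    simpa using d.clm_apply_eq
        (U.toContinuousLinearEquiv.toContinuousLinearMap ∘L tensorLeft G (hTmul x y))
        (tensorRight _ y ∘L tensorLeft G x) (fun i ↦ by simp [h2]) z⟩

theorem exists_rotate_hTmul :
    ∃ U : HilbertTensor (HilbertTensor E F) G ≃ₗᵢ[ℂ] HilbertTensor (HilbertTensor G E) F,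
    ∀ x y z, U (hTmul (hTmul x y) z) = hTmul (hTmul z x) y := by
  obtain ⟨_, b, -⟩ := exists_hilbertBasis ℂ E
  obtain ⟨_, c, -⟩ := exists_hilbertBasis ℂ F
  obtain ⟨_, d, -⟩ := exists_hilbertBasis ℂ G
  obtain ⟨U, hU⟩ := ((b.hTmul c).hTmul d).exists_linearIsometryEquiv ((d.hTmul b).hTmul c)
    ⟨fun p ↦ ((p.2, p.1.1), p.1.2), fun p ↦ ((p.1.2, p.2), p.1.1), fun _ ↦ rfl, fun _ ↦ rfl⟩
  have h0 : ∀ i j k, U (hTmul (hTmul (b i) (c j)) (d k)) = hTmul (hTmul (d k) (b i)) (c j) :=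
    fun i j k ↦ by simpa using hU ((i, j), k)
  have h1 : ∀ x j k, U (hTmul (hTmul x (c j)) (d k)) = hTmul (hTmul (d k) x) (c j) :=
    fun x j k ↦ by
      simpa using b.clm_apply_eq
        (U.toContinuousLinearEquiv.toContinuousLinearMap ∘L tensorRight _ (d k) ∘L
          tensorRight E (c j))
        (tensorRight _ (c j) ∘L tensorLeft E (d k)) (fun i ↦ by simp [h0]) x
  have h2 : ∀ x y k, U (hTmul (hTmul x y) (d k)) = hTmul (hTmul (d k) x) y :=
    fun x y k ↦ by
      simpa using c.clm_apply_eq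
        (U.toContinuousLinearEquiv.toContinuousLinearMap ∘L tensorRight _ (d k) ∘L tensorLeft F x)
        (tensorLeft F (hTmul (d k) x)) (fun i ↦ by simp [h1]) y
  exact ⟨U, fun x y z ↦ by
    simpa using d.clm_apply_eq
        (U.toContinuousLinearEquiv.toContinuousLinearMap ∘L tensorLeft G (hTmul x y))
        (tensorRight _ y ∘L tensorRight G x) (fun i ↦ by simp [h2]) z⟩

end Rearrangement

/-! ### Hilbert-Schmidt operators -/

section HilbertSchmidt

variable {E F K : Type*} [NormedAddCommGroup E] [InnerProductSpace ℂ E]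
  [NormedAddCommGroup F] [InnerProductSpace ℂ F] [NormedAddCommGroup K] [InnerProductSpace ℂ K]

omit [InnerProductSpace ℂ E] in
theorem enorm_sq_eq_ofReal (x : E) : ‖x‖ₑ ^ 2 = ENNReal.ofReal (‖x‖ ^ 2) := by
  rw [ENNReal.ofReal_pow (norm_nonneg x), ofReal_norm]

theorem HilbertBasis.hasSum_norm_inner_sq {ι : Type*} (b : HilbertBasis ι ℂ E) (x : E) :
    HasSum (fun i ↦ ‖⟪b i, x⟫_ℂ‖ ^ 2) (‖x‖ ^ 2) := by
  have h := Complex.hasSum_re (b.hasSum_inner_mul_inner x x)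
  convert h using 1
  · ext i
    rw [← inner_conj_symm x (b i), ← Complex.normSq_eq_conj_mul_self, Complex.normSq_eq_norm_sq,
      Complex.ofReal_re]
  · exact norm_sq_eq_re_inner (𝕜 := ℂ) x

theorem HilbertBasis.tsum_enorm_inner_sq {ι : Type*} (b : HilbertBasis ι ℂ E) (x : E) :
    ∑' i, ‖⟪b i, x⟫_ℂ‖ₑ ^ 2 = ‖x‖ₑ ^ 2 := by
  rw [enorm_sq_eq_ofReal, ← (b.hasSum_norm_inner_sq x).tsum_eq,
    ENNReal.ofReal_tsum_of_nonneg (fun _ ↦ by positivity) (b.hasSum_norm_inner_sq x).summable]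
  exact tsum_congr fun i ↦ enorm_sq_eq_ofReal _

variable [CompleteSpace E] [CompleteSpace F] [CompleteSpace K]

/-- Parseval turns both sides into the double sum of squared matrix entries, and in `ENNReal` the
order of summation is free. Since `b` and `c` are unrelated, basis independence follows by passing
through the adjoint. -/
theorem tsum_enorm_sq_eq_tsum_enorm_adjoint_sq {ι κ : Type*} (X : E →L[ℂ] F)
    (b : HilbertBasis ι ℂ E) (c : HilbertBasis κ ℂ F) :
    ∑' i, ‖X (b i)‖ₑ ^ 2 = ∑' j, ‖adjoint X (c j)‖ₑ ^ 2 := by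
  simp_rw [← b.tsum_enorm_inner_sq, ← c.tsum_enorm_inner_sq]
  rw [ENNReal.tsum_comm]
  refine tsum_congr fun j ↦ tsum_congr fun i ↦ ?_
  rw [adjoint_inner_right, ← inner_conj_symm, RCLike.enorm_conj]

/-- The square of the Hilbert-Schmidt norm of a bounded operator. -/
noncomputable def hsSq (X : E →L[ℂ] F) : ENNReal :=
  ∑' i, ‖X ((exists_hilbertBasis ℂ E).choose_spec.choose i)‖ₑ ^ 2

theorem hsSq_eq_tsum {ι : Type*} (X : E →L[ℂ] F) (b : HilbertBasis ι ℂ E) :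
    hsSq X = ∑' i, ‖X (b i)‖ₑ ^ 2 := by
  obtain ⟨_, c, -⟩ := exists_hilbertBasis ℂ F
  rw [hsSq, tsum_enorm_sq_eq_tsum_enorm_adjoint_sq X _ c,
    tsum_enorm_sq_eq_tsum_enorm_adjoint_sq X b c]

theorem hsSq_adjoint (X : E →L[ℂ] F) : hsSq (adjoint X) = hsSq X := by
  obtain ⟨_, b, -⟩ := exists_hilbertBasis ℂ E
  obtain ⟨_, c, -⟩ := exists_hilbertBasis ℂ F
  rw [hsSq_eq_tsum X b, tsum_enorm_sq_eq_tsum_enorm_adjoint_sq X b c, hsSq_eq_tsum _ c]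

omit [CompleteSpace F] [CompleteSpace K] in
theorem hsSq_comp_left_le (A : F →L[ℂ] K) (X : E →L[ℂ] F) :
    hsSq (A ∘L X) ≤ ‖A‖ₑ ^ 2 * hsSq X := by
  rw [hsSq, hsSq, ← ENNReal.tsum_mul_left]
  refine ENNReal.tsum_le_tsum fun i ↦ ?_
  rw [← mul_pow]
  gcongr
  exact A.le_opENorm _

theorem hsSq_comp_right_le (X : F →L[ℂ] K) (A : E →L[ℂ] F) :
    hsSq (X ∘L A) ≤ ‖A‖ₑ ^ 2 * hsSq X := by
  rw [← hsSq_adjoint, adjoint_comp, ← hsSq_adjoint X]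
  refine (hsSq_comp_left_le _ _).trans_eq ?_
  rw [← ofReal_norm, ← ofReal_norm, LinearIsometryEquiv.norm_map]

theorem hsSq_comp_right_ne_top {X : F →L[ℂ] K} (hX : hsSq X ≠ ⊤) (A : E →L[ℂ] F) :
    hsSq (X ∘L A) ≠ ⊤ :=
  ne_top_of_le_ne_top (ENNReal.mul_ne_top (by simp) hX) (hsSq_comp_right_le X A)

omit [CompleteSpace F] in
theorem hsSq_smul_ne_top {X : E →L[ℂ] F} (hX : hsSq X ≠ ⊤) (c : ℂ) : hsSq (c • X) ≠ ⊤ := by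
  have : c • X = (c • ContinuousLinearMap.id ℂ F) ∘L X := by ext; simp
  rw [this]
  exact ne_top_of_le_ne_top (ENNReal.mul_ne_top (by simp) hX) (hsSq_comp_left_le _ X)

theorem hsSq_ne_top_iff {ι : Type*} {X : E →L[ℂ] F} (b : HilbertBasis ι ℂ E) :
    hsSq X ≠ ⊤ ↔ Summable fun i ↦ ‖X (b i)‖ ^ 2 := by
  rw [hsSq_eq_tsum X b]
  simp_rw [enorm_sq_eq_ofReal]
  refine ⟨fun h ↦ ?_, fun h ↦ h.tsum_ofReal_ne_top⟩
  exact (ENNReal.summable_toReal h).congr fun i ↦ ENNReal.toReal_ofReal (by positivity)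

theorem hasSum_norm_sq_hsSq {ι : Type*} {X : E →L[ℂ] F} (hX : hsSq X ≠ ⊤)
    (b : HilbertBasis ι ℂ E) : HasSum (fun i ↦ ‖X (b i)‖ ^ 2) (hsSq X).toReal := by
  have h := (hsSq_ne_top_iff b).1 hX
  have h' : (hsSq X).toReal = ∑' i, ‖X (b i)‖ ^ 2 := by
    rw [hsSq_eq_tsum X b]
    simp_rw [enorm_sq_eq_ofReal]
    rw [← ENNReal.ofReal_tsum_of_nonneg (fun _ ↦ by positivity) h,
      ENNReal.toReal_ofReal (tsum_nonneg fun _ ↦ by positivity)]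
  exact h' ▸ h.hasSum

theorem hsSq_add_ne_top {X Y : E →L[ℂ] F} (hX : hsSq X ≠ ⊤) (hY : hsSq Y ≠ ⊤) :
    hsSq (X + Y) ≠ ⊤ := by
  obtain ⟨_, b, -⟩ := exists_hilbertBasis ℂ E
  rw [hsSq_ne_top_iff b] at *
  refine .of_nonneg_of_le (fun _ ↦ by positivity) (fun i ↦ ?_) ((hX.add hY).mul_left 2)
  have h := norm_add_le (X (b i)) (Y (b i))
  have h' : ‖X (b i) + Y (b i)‖ ^ 2 ≤ (‖X (b i)‖ + ‖Y (b i)‖) ^ 2 := by gcongr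
  simp only [add_apply]
  nlinarith [sq_nonneg (‖X (b i)‖ - ‖Y (b i)‖)]

/-- Cauchy-Schwarz bounds each coefficient of `X x` along `c j` by the norm of `adjoint X (c j)`
times that of `x`; the squares sum to the claim. It follows that the Hilbert-Schmidt norm dominates
the operator norm. -/
theorem enorm_apply_sq_le (X : E →L[ℂ] F) (x : E) : ‖X x‖ₑ ^ 2 ≤ hsSq X * ‖x‖ₑ ^ 2 := by
  obtain ⟨_, c, -⟩ := exists_hilbertBasis ℂ F
  rw [← hsSq_adjoint X, hsSq_eq_tsum _ c, ← ENNReal.tsum_mul_right, ← c.tsum_enorm_inner_sq]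
  refine ENNReal.tsum_le_tsum fun j ↦ ?_
  rw [← adjoint_inner_left, ← mul_pow]
  gcongr
  rw [← ofReal_norm, ← ofReal_norm, ← ofReal_norm, ← ENNReal.ofReal_mul (norm_nonneg _)]
  exact ENNReal.ofReal_le_ofReal (norm_inner_le_norm _ _)

theorem norm_sq_le_toReal_hsSq {X : E →L[ℂ] F} (hX : hsSq X ≠ ⊤) : ‖X‖ ^ 2 ≤ (hsSq X).toReal := by
  rw [← Real.le_sqrt (norm_nonneg _) ENNReal.toReal_nonneg]
  refine opNorm_le_bound _ (Real.sqrt_nonneg _) fun x ↦ ?_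
  refine le_of_sq_le_sq ?_ (by positivity)
  have h := ENNReal.toReal_mono (ENNReal.mul_ne_top hX (by simp)) (enorm_apply_sq_le X x)
  rw [mul_pow, Real.sq_sqrt ENNReal.toReal_nonneg]
  simpa using h

/-- The Hilbert-Schmidt inner product, written through the polarization identity. -/
noncomputable def hsInner (X Y : E →L[ℂ] F) : ℂ :=
  (((hsSq (X + Y)).toReal : ℂ) - ((hsSq (X - Y)).toReal : ℂ) +
    (((hsSq (X - Complex.I • Y)).toReal : ℂ) - ((hsSq (X + Complex.I • Y)).toReal : ℂ)) *
      Complex.I) / 4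

/-- Polarization reduces the sum to four Hilbert-Schmidt norms, so its value is the same in every
basis. This is what makes partial traces basis independent. -/
theorem hasSum_hsInner {X Y : E →L[ℂ] F} (hX : hsSq X ≠ ⊤) (hY : hsSq Y ≠ ⊤) {ι : Type*}
    (b : HilbertBasis ι ℂ E) : HasSum (fun i ↦ ⟪X (b i), Y (b i)⟫_ℂ) (hsInner X Y) := by
  have hneg : ∀ {Z : E →L[ℂ] F}, hsSq Z ≠ ⊤ → hsSq (X - Z) ≠ ⊤ := fun {Z} hZ ↦ by
    simpa [sub_eq_add_neg] using hsSq_add_ne_top hX (hsSq_smul_ne_top hZ (-1))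
  have hI := hsSq_smul_ne_top hY Complex.I
  have h : ∀ {Z : E →L[ℂ] F}, hsSq Z ≠ ⊤ →
      HasSum (fun i ↦ ((‖Z (b i)‖ ^ 2 : ℝ) : ℂ)) ((hsSq Z).toReal : ℂ) := fun hZ ↦
    Complex.hasSum_ofReal.2 (hasSum_norm_sq_hsSq hZ b)
  have key := ((((h (hsSq_add_ne_top hX hY)).sub (h (hneg hY))).add
    (((h (hneg hI)).sub (h (hsSq_add_ne_top hX hI))).mul_right Complex.I)).div_const 4)
  simp only [Complex.ofReal_pow] at key
  simp_rw [inner_eq_sum_norm_sq_div_four]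
  exact key

end HilbertSchmidt

/-! ### Positive trace class operators and their differences -/

section PositiveTraceClass

variable {E F : Type*} [NormedAddCommGroup E] [InnerProductSpace ℂ E]
  [NormedAddCommGroup F] [InnerProductSpace ℂ F] [CompleteSpace E] [CompleteSpace F]

theorem ContinuousLinearMap.IsPositive.inner_eq_inner_sqrt {T : E →L[ℂ] E} (hT : T.IsPositive)
    (x y : E) : ⟪x, T y⟫_ℂ = ⟪CFC.sqrt T x, CFC.sqrt T y⟫_ℂ := by
  have h0 : 0 ≤ T := (nonneg_iff_isPositive T).2 hT
  have h1 : (CFC.sqrt T).IsPositive := (nonneg_iff_isPositive _).1 (CFC.sqrt_nonneg T)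
  conv_lhs => rw [← CFC.sqrt_mul_sqrt_self T]
  exact (h1.inner_left_eq_inner_right _ _).symm

theorem ContinuousLinearMap.IsPositive.re_inner_eq_norm_sqrt_sq {T : E →L[ℂ] E}
    (hT : T.IsPositive) (x : E) : (⟪x, T x⟫_ℂ).re = ‖CFC.sqrt T x‖ ^ 2 := by
  rw [hT.inner_eq_inner_sqrt]
  exact (norm_sq_eq_re_inner (𝕜 := ℂ) _).symm

/-- Positive trace class operators: the square root is Hilbert-Schmidt. -/
structure IsPosTraceClass (T : E →L[ℂ] E) : Prop where
  isPositive : T.IsPositive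
  hsSq_sqrt_ne_top : hsSq (CFC.sqrt T) ≠ ⊤

/-- The diagonal entries are the squared norms of the images under the square root, so checking a
single basis suffices. -/
theorem ContinuousLinearMap.IsPositive.isPosTraceClass_iff {T : E →L[ℂ] E} (hT : T.IsPositive)
    {ι : Type*} (b : HilbertBasis ι ℂ E) :
    IsPosTraceClass T ↔ Summable fun i ↦ (⟪b i, T (b i)⟫_ℂ).re := by
  simp_rw [hT.re_inner_eq_norm_sqrt_sq]
  rw [← hsSq_ne_top_iff b]
  exact ⟨fun h ↦ h.2, fun h ↦ ⟨hT, h⟩⟩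

theorem IsPosTraceClass.isTraceClass {T : E →L[ℂ] E} (hT : IsPosTraceClass T) :
    IsTraceClass T := fun ι b ↦ by
  have h0 : 0 ≤ T := (nonneg_iff_isPositive T).2 hT.isPositive
  rw [CFC.abs_of_nonneg T]
  exact (hT.isPositive.isPosTraceClass_iff b).1 hT

theorem IsDensityOperator.isPosTraceClass {T : E →L[ℂ] E} (hT : IsDensityOperator T) :
    IsPosTraceClass T := by
  obtain ⟨_, b, -⟩ := exists_hilbertBasis ℂ E
  exact (hT.isPositive.isPosTraceClass_iff b).2
    (Complex.hasSum_re (hT.hasTrace_one _ b)).summable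

theorem IsPosTraceClass.add {S T : E →L[ℂ] E} (hS : IsPosTraceClass S) (hT : IsPosTraceClass T) :
    IsPosTraceClass (S + T) := by
  obtain ⟨_, b, -⟩ := exists_hilbertBasis ℂ E
  rw [(hS.isPositive.add hT.isPositive).isPosTraceClass_iff b]
  simpa using ((hS.isPositive.isPosTraceClass_iff b).1 hS).add
    ((hT.isPositive.isPosTraceClass_iff b).1 hT)

theorem IsPosTraceClass.of_eq_adjoint_comp_self {X : E →L[ℂ] F} (hX : hsSq X ≠ ⊤) :
    IsPosTraceClass (adjoint X ∘L X) := by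
  obtain ⟨_, b, -⟩ := exists_hilbertBasis ℂ E
  rw [(isPositive_adjoint_comp_self X).isPosTraceClass_iff b]
  refine ((hsSq_ne_top_iff b).1 hX).congr fun i ↦ ?_
  rw [comp_apply, adjoint_inner_right]
  exact norm_sq_eq_re_inner (𝕜 := ℂ) _

theorem IsPosTraceClass.eq_adjoint_comp_self {T : E →L[ℂ] E} (hT : IsPosTraceClass T) :
    T = adjoint (CFC.sqrt T) ∘L CFC.sqrt T := by
  ext y
  refine ext_inner_left ℂ fun x ↦ ?_
  rw [comp_apply, adjoint_inner_right, hT.isPositive.inner_eq_inner_sqrt]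

/-- With `Q` the square root of `T`, the conjugate is `(Q A)* (Q A)`, and `Q A` is still
Hilbert-Schmidt. -/
theorem IsPosTraceClass.conj {T : E →L[ℂ] E} (hT : IsPosTraceClass T) (A : F →L[ℂ] E) :
    IsPosTraceClass (adjoint A ∘L T ∘L A) := by
  have h := IsPosTraceClass.of_eq_adjoint_comp_self
    (hsSq_comp_right_ne_top hT.hsSq_sqrt_ne_top A)
  rw [adjoint_comp] at h
  rw [hT.eq_adjoint_comp_self]
  exact h

omit [CompleteSpace E] [CompleteSpace F] in
theorem enorm_hTmul (x : E) (y : F) : ‖hTmul x y‖ₑ = ‖x‖ₑ * ‖y‖ₑ := by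
  rw [← ofReal_norm, ← ofReal_norm, ← ofReal_norm, ← ENNReal.ofReal_mul (norm_nonneg _), hTmul,
    Completion.norm_coe, TensorProduct.norm_tmul]

theorem hsSq_opTensor (A : E →L[ℂ] E) (B : F →L[ℂ] F) :
    hsSq (opTensor A B) = hsSq A * hsSq B := by
  obtain ⟨_, b, -⟩ := exists_hilbertBasis ℂ E
  obtain ⟨_, c, -⟩ := exists_hilbertBasis ℂ F
  rw [hsSq_eq_tsum A b, hsSq_eq_tsum B c, hsSq_eq_tsum _ (b.hTmul c), ENNReal.tsum_prod',
    ← ENNReal.tsum_mul_right]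
  refine tsum_congr fun i ↦ ?_
  rw [← ENNReal.tsum_mul_left]
  refine tsum_congr fun j ↦ ?_
  rw [HilbertBasis.hTmul_apply, opTensor_hTmul, enorm_hTmul, mul_pow]

theorem IsPosTraceClass.opTensor {A : E →L[ℂ] E} {B : F →L[ℂ] F} (hA : IsPosTraceClass A)
    (hB : IsPosTraceClass B) : IsPosTraceClass (opTensor A B) := by
  have h := IsPosTraceClass.of_eq_adjoint_comp_self (X := _root_.opTensor (CFC.sqrt A) (CFC.sqrt B))
    (by rw [hsSq_opTensor]; exact ENNReal.mul_ne_top hA.2 hB.2)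
  rwa [adjoint_opTensor, ← opTensor_comp, ← hA.eq_adjoint_comp_self,
    ← hB.eq_adjoint_comp_self] at h

/-- Take `T = (|T| + T) - |T|`. Both terms are positive, and `T ≤ |T|` bounds the diagonal of the
first by twice that of `|T|`. -/
theorem IsTraceClass.exists_eq_sub {T : E →L[ℂ] E} (hT : IsTraceClass T) (hsa : IsSelfAdjoint T) :
    ∃ P N, IsPosTraceClass P ∧ IsPosTraceClass N ∧ T = P - N := by
  obtain ⟨_, b, -⟩ := exists_hilbertBasis ℂ E
  have hN : (CFC.abs T).IsPositive := (nonneg_iff_isPositive _).1 (CFC.abs_nonneg T)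
  have hP : (CFC.abs T + T).IsPositive := by
    rw [← nonneg_iff_isPositive, CFC.abs_add_self T]
    exact nsmul_nonneg (CFC.posPart_nonneg T) 2
  have hM : (CFC.abs T - T).IsPositive := by
    rw [← nonneg_iff_isPositive, CFC.abs_sub_self T]
    exact nsmul_nonneg (CFC.negPart_nonneg T) 2
  have hs := hT _ b
  refine ⟨CFC.abs T + T, CFC.abs T, (hP.isPosTraceClass_iff b).2 ?_,
    (hN.isPosTraceClass_iff b).2 hs, by abel⟩
  refine .of_nonneg_of_le (fun i ↦ hP.re_inner_nonneg_right _) (fun i ↦ ?_) (hs.mul_left 2)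
  have := hM.re_inner_nonneg_right (b i)
  simp [inner_sub_right] at this ⊢
  linarith

/-- Polar decomposition is replaced by an approximation: `|S|` is a norm limit of products `S C`
with `C` a contraction. For such `C` the diagonal sums of `P C` and `N C` are bounded by
Hilbert-Schmidt norms, uniformly in `C`, which bounds every finite partial sum for `|S|`. -/
theorem isTraceClass_sub {P N : E →L[ℂ] E} (hP : IsPosTraceClass P) (hN : IsPosTraceClass N) :
    IsTraceClass (P - N) := fun ι b ↦ by
  set S := P - N with hS
  have hsa : IsSelfAdjoint S := hP.isPositive.isSelfAdjoint.sub hN.isPositive.isSelfAdjoint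
  have hpos : (CFC.abs S).IsPositive := (nonneg_iff_isPositive _).1 (CFC.abs_nonneg S)
  -- The function `x / (|x| + ε)` is a continuous substitute for the sign; the error `|x| ε / (|x| +
  -- ε)` is at most `ε`.
  have approx : ∀ ε : ℝ, 0 < ε → ∃ C : E →L[ℂ] E, ‖C‖ ≤ 1 ∧ ‖CFC.abs S - S * C‖ ≤ ε := by
    intro ε hε
    have hc : Continuous fun x : ℝ ↦ x / (|x| + ε) :=
      continuous_id.div (by fun_prop) fun x ↦ by positivity
    refine ⟨cfc (fun x : ℝ ↦ x / (|x| + ε)) S, ?_, ?_⟩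
    · refine norm_cfc_le zero_le_one fun x _ ↦ ?_
      rw [norm_div, Real.norm_eq_abs, Real.norm_of_nonneg (by positivity : 0 ≤ |x| + ε)]
      exact div_le_one_of_le₀ (by linarith) (by positivity)
    · have h1 : S * cfc (fun x : ℝ ↦ x / (|x| + ε)) S =
          cfc (fun x : ℝ ↦ x * (x / (|x| + ε))) S := by
        conv_lhs => rw [← cfc_id' ℝ S]
        rw [cfc_id' ℝ S, cfc_mul (fun x ↦ x) _ S (by fun_prop) hc.continuousOn, cfc_id' ℝ S]
      rw [h1, CFC.abs_eq_cfc_norm S,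
        ← cfc_sub (fun x : ℝ ↦ ‖x‖) (fun x : ℝ ↦ x * (x / (|x| + ε))) S (by fun_prop)
        (ContinuousOn.mul continuousOn_id hc.continuousOn)]
      refine norm_cfc_le hε.le fun x _ ↦ ?_
      have h2 : ‖x‖ - x * (x / (|x| + ε)) = |x| * ε / (|x| + ε) := by
        have : |x| + ε ≠ 0 := by positivity
        field_simp
        rw [Real.norm_eq_abs, ← sq_abs x]
        ring
      rw [h2, Real.norm_of_nonneg (by positivity), div_le_iff₀ (by positivity)]
      nlinarith [abs_nonneg x]
  -- Split `Q` into two square roots, apply Cauchy-Schwarz and the arithmetic-geometric mean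
  -- inequality; right multiplication by a contraction does not increase `hsSq`.
  have bound : ∀ {Q : E →L[ℂ] E}, IsPosTraceClass Q → ∀ {C : E →L[ℂ] E}, ‖C‖ ≤ 1 →
      ∀ s : Finset ι, ∑ i ∈ s, ‖⟪b i, Q (C (b i))⟫_ℂ‖ ≤ (hsSq (CFC.sqrt Q)).toReal := by
    intro Q hQ C hC s
    have hX := hQ.hsSq_sqrt_ne_top
    have hXC := hsSq_comp_right_ne_top hX C
    have hle : (hsSq (CFC.sqrt Q ∘L C)).toReal ≤ (hsSq (CFC.sqrt Q)).toReal := by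
      refine ENNReal.toReal_mono hX ((hsSq_comp_right_le _ C).trans ?_)
      refine mul_le_of_le_one_left (by positivity) (pow_le_one₀ (by positivity) ?_)
      rw [← ofReal_norm]
      exact ENNReal.ofReal_le_one.2 hC
    have h1 := sum_le_hasSum s (fun _ _ ↦ by positivity) (hasSum_norm_sq_hsSq hX b)
    have h2 := sum_le_hasSum s (fun _ _ ↦ by positivity) (hasSum_norm_sq_hsSq hXC b)
    have h3 : ∑ i ∈ s, ‖⟪b i, Q (C (b i))⟫_ℂ‖ ≤
        ∑ i ∈ s, (‖CFC.sqrt Q (b i)‖ ^ 2 + ‖(CFC.sqrt Q ∘L C) (b i)‖ ^ 2) / 2 := by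
      refine Finset.sum_le_sum fun i _ ↦ ?_
      rw [hQ.isPositive.inner_eq_inner_sqrt, comp_apply]
      refine (norm_inner_le_norm _ _).trans ?_
      nlinarith [sq_nonneg (‖CFC.sqrt Q (b i)‖ - ‖CFC.sqrt Q (C (b i))‖)]
    rw [← Finset.sum_div, Finset.sum_add_distrib] at h3
    linarith
  refine summable_of_sum_le (c := (hsSq (CFC.sqrt P)).toReal + (hsSq (CFC.sqrt N)).toReal)
    (fun i ↦ hpos.re_inner_nonneg_right (b i)) fun s ↦ ?_
  refine le_of_forall_pos_le_add fun δ hδ ↦ ?_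
  -- The error per basis vector is chosen so that the total over `s` is at most `δ`; the `+ 1`
  -- covers empty `s`.
  obtain ⟨C, hC, hSC⟩ := approx (δ / (s.card + 1)) (by positivity)
  have hterm : ∀ i, (⟪b i, CFC.abs S (b i)⟫_ℂ).re ≤
      ‖⟪b i, P (C (b i))⟫_ℂ‖ + ‖⟪b i, N (C (b i))⟫_ℂ‖ + δ / (s.card + 1) := by
    intro i
    have h1 : ⟪b i, CFC.abs S (b i)⟫_ℂ = ⟪b i, P (C (b i))⟫_ℂ - ⟪b i, N (C (b i))⟫_ℂ +
        ⟪b i, (CFC.abs S - S * C) (b i)⟫_ℂ := by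
      simp [hS]
    have h2 : ‖⟪b i, (CFC.abs S - S * C) (b i)⟫_ℂ‖ ≤ δ / (s.card + 1) := by
      refine (norm_inner_le_norm _ _).trans ?_
      rw [b.orthonormal.1 i, one_mul]
      refine (le_opNorm _ _).trans ?_
      rwa [b.orthonormal.1 i, mul_one]
    refine (Complex.re_le_norm _).trans ?_
    rw [h1]
    exact (norm_add_le _ _).trans (add_le_add (norm_sub_le _ _) h2)
  refine (Finset.sum_le_sum fun i _ ↦ hterm i).trans ?_
  rw [Finset.sum_add_distrib, Finset.sum_add_distrib, Finset.sum_const, nsmul_eq_mul]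
  have h3 : (s.card : ℝ) * (δ / (s.card + 1)) ≤ δ := by
    rw [mul_div_assoc', div_le_iff₀ (by positivity)]
    nlinarith
  linarith [bound hP hC s, bound hN hC s]

end PositiveTraceClass

/-! ### Block decompositions converging in norm -/

section Pinching

variable {H : Type*} [NormedAddCommGroup H] [InnerProductSpace ℂ H] [CompleteSpace H]

theorem hsSq_eq_tsum_inner {κ : Type*} (Y : H →L[ℂ] H) (c : HilbertBasis κ ℂ H) :
    hsSq Y = ∑' p : κ × κ, ‖⟪c p.1, Y (c p.2)⟫_ℂ‖ₑ ^ 2 := by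
  rw [hsSq_eq_tsum Y c, ENNReal.tsum_prod', ENNReal.tsum_comm]
  exact tsum_congr fun i ↦ (c.tsum_enorm_inner_sq _).symm

/-- A Hilbert-Schmidt operator is the unconditional sum, in operator norm, of its blocks with
respect to any partition of a Hilbert basis. -/
theorem hasSum_blocks {ι κ : Type*} {X : H →L[ℂ] H} (hX : hsSq X ≠ ⊤) (c : HilbertBasis κ ℂ H)
    (l : κ → ι) (D : ι × ι → H →L[ℂ] H)
    (hl : ∀ p i j, (l i, l j) = p → ⟪c i, D p (c j)⟫_ℂ = ⟪c i, X (c j)⟫_ℂ)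
    (hl' : ∀ p i j, (l i, l j) ≠ p → ⟪c i, D p (c j)⟫_ℂ = 0) : HasSum D X := by
  classical
  let f : κ × κ → ℝ := fun q ↦ ‖⟪c q.1, X (c q.2)⟫_ℂ‖ ^ 2
  have hf : Summable f := by
    rw [hsSq_eq_tsum_inner X c] at hX
    refine (ENNReal.summable_toReal hX).congr fun q ↦ ?_
    simp [f]
  let g : Finset (ι × ι) → κ × κ → ℝ := fun s q ↦ if (l q.1, l q.2) ∈ s then 0 else f q
  have hf0 : ∀ q, 0 ≤ f q := fun q ↦ by positivity
  have hg0 : ∀ s q, 0 ≤ g s q := fun s q ↦ by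
    simp only [g]; split_ifs <;> simp [hf0]
  have hgf : ∀ s q, g s q ≤ f q := fun s q ↦ by
    simp only [g]; split_ifs <;> simp [hf0]
  have hgs : ∀ s, Summable (g s) := fun s ↦ .of_nonneg_of_le (hg0 s) (hgf s) hf
  -- Each matrix entry eventually belongs to a block already summed, so the remaining mass tends to
  -- zero by dominated convergence.
  have hlim : Filter.Tendsto (fun s ↦ ∑' q, g s q) Filter.atTop (nhds 0) := by
    have := tendsto_tsum_of_dominated_convergence (𝓕 := Filter.atTop) (f := g) (g := fun _ ↦ 0)
      hf (fun q ↦ ?_) (Filter.Eventually.of_forall fun s q ↦ ?_)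
    · simpa using this
    · refine tendsto_const_nhds.congr' ?_
      filter_upwards [Filter.eventually_ge_atTop {(l q.1, l q.2)}] with s hs
      simp only [g]
      rw [if_pos (hs (by simp))]
    · rw [Real.norm_of_nonneg (hg0 s q)]
      exact hgf s q
  have hinner : ∀ s q, ‖⟪c q.1, (∑ p ∈ s, D p - X) (c q.2)⟫_ℂ‖ ^ 2 = g s q := by
    intro s q
    have h1 : ⟪c q.1, (∑ p ∈ s, D p) (c q.2)⟫_ℂ =
        if (l q.1, l q.2) ∈ s then ⟪c q.1, X (c q.2)⟫_ℂ else 0 := by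
      rw [sum_apply, inner_sum]
      split_ifs with h
      · rw [Finset.sum_eq_single_of_mem _ h fun p _ hp ↦ hl' p _ _ hp.symm, hl _ _ _ rfl]
      · exact Finset.sum_eq_zero fun p hp ↦ hl' p _ _ fun e ↦ h (e ▸ hp)
    rw [sub_apply, inner_sub_right, h1]
    simp only [g, f]
    split_ifs <;> simp
  -- The remaining mass is the squared Hilbert-Schmidt norm of the remainder, which dominates its
  -- operator norm.
  have hnorm : ∀ s, ‖∑ p ∈ s, D p - X‖ ^ 2 ≤ ∑' q, g s q := by
    intro s
    have h1 : hsSq (∑ p ∈ s, D p - X) = ENNReal.ofReal (∑' q, g s q) := by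
      rw [hsSq_eq_tsum_inner _ c, ENNReal.ofReal_tsum_of_nonneg (hg0 s) (hgs s)]
      refine tsum_congr fun q ↦ ?_
      rw [enorm_sq_eq_ofReal, hinner]
    have h2 := norm_sq_le_toReal_hsSq (X := ∑ p ∈ s, D p - X) (by simp [h1])
    rwa [h1, ENNReal.toReal_ofReal (tsum_nonneg (hg0 s))] at h2
  rw [HasSum, SummationFilter.unconditional_filter, tendsto_iff_norm_sub_tendsto_zero]
  have h := (squeeze_zero (fun s ↦ by positivity) hnorm hlim).sqrt
  simpa using h

end Pinching

/-! ### Block series, partial traces and existence of density operators -/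

section PartialTrace

variable {E F : Type*} [NormedAddCommGroup E] [InnerProductSpace ℂ E]
  [NormedAddCommGroup F] [InnerProductSpace ℂ F] [CompleteSpace E] [CompleteSpace F]

theorem IsPosTraceClass.hsSq_ne_top {T : E →L[ℂ] E} (hT : IsPosTraceClass T) : hsSq T ≠ ⊤ := by
  rw [hT.eq_adjoint_comp_self]
  exact hsSq_comp_right_ne_top (by rw [hsSq_adjoint]; exact hT.2) _

theorem IsPosTraceClass.exists_sqrt {T : E →L[ℂ] E} (hT : IsPosTraceClass T) :
    ∃ X : E →L[ℂ] E, hsSq X ≠ ⊤ ∧ ∀ x y, ⟪x, T y⟫_ℂ = ⟪X x, X y⟫_ℂ :=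
  ⟨_, hT.hsSq_sqrt_ne_top, hT.isPositive.inner_eq_inner_sqrt⟩

-- The product basis is partitioned by its second index; the summand for `(n, m)` carries exactly
-- the matrix entries of ρ between classes `n` and `m`.
omit [CompleteSpace F] in
theorem hasSum_blockRight {ι : Type*} {ρ : HilbertTensor E F →L[ℂ] HilbertTensor E F}
    (hρ : hsSq ρ ≠ ⊤) (φ : HilbertBasis ι ℂ F) :
    HasSum (fun p : ι × ι ↦ opTensor (blockRight ρ (φ p.1) (φ p.2)) (ketBra (φ p.1) (φ p.2))) ρ := by
  classical
  obtain ⟨_, b, -⟩ := exists_hilbertBasis ℂ E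
  have ho := orthonormal_iff_ite.1 φ.orthonormal
  refine hasSum_blocks hρ (b.hTmul φ) Prod.snd _ ?_ ?_
  · rintro _ i j rfl
    simp [blockRight, ketBra, adjoint_inner_right, φ.orthonormal.1]
  · rintro ⟨n, m⟩ i j h
    simp only [ne_eq, Prod.mk.injEq, not_and_or] at h
    simp only [HilbertBasis.hTmul_apply, opTensor_hTmul, ketBra, inner_hTmul,
      InnerProductSpace.rankOne_apply, inner_smul_right, ho]
    rcases h with h | h
    · simp [h]
    · simp [Ne.symm h]

omit [CompleteSpace E] in
theorem hasSum_blockLeft {ι : Type*} {ρ : HilbertTensor E F →L[ℂ] HilbertTensor E F}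
    (hρ : hsSq ρ ≠ ⊤) (e : HilbertBasis ι ℂ E) :
    HasSum (fun p : ι × ι ↦ opTensor (ketBra (e p.1) (e p.2)) (blockLeft ρ (e p.1) (e p.2))) ρ := by
  classical
  obtain ⟨_, b, -⟩ := exists_hilbertBasis ℂ F
  have ho := orthonormal_iff_ite.1 e.orthonormal
  refine hasSum_blocks hρ (e.hTmul b) Prod.fst _ ?_ ?_
  · rintro _ i j rfl
    simp [blockLeft, ketBra, adjoint_inner_right, e.orthonormal.1]
  · rintro ⟨n, m⟩ i j h
    simp only [ne_eq, Prod.mk.injEq, not_and_or] at h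
    simp only [HilbertBasis.hTmul_apply, opTensor_hTmul, ketBra, inner_hTmul,
      InnerProductSpace.rankOne_apply, inner_smul_right, ho]
    rcases h with h | h
    · simp [h]
    · simp [Ne.symm h]

/-- With `X` a Hilbert-Schmidt square root of ρ, the slices `T j = X (· ⊗ c j)` have `hsSq` summing
to that of `X`, and the partial trace is the sum of `(T j)* (T j)`. -/
theorem IsPosTraceClass.exists_isPartialTraceRight
    {ρ : HilbertTensor E F →L[ℂ] HilbertTensor E F} (hρ : IsPosTraceClass ρ) :
    ∃ r, IsPosTraceClass r ∧ IsPartialTraceRight ρ r := by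
  obtain ⟨_, a, -⟩ := exists_hilbertBasis ℂ E
  obtain ⟨κ, c, -⟩ := exists_hilbertBasis ℂ F
  obtain ⟨X, hX, hXρ⟩ := hρ.exists_sqrt
  let T : κ → E →L[ℂ] HilbertTensor E F := fun j ↦ X ∘L tensorRight E (c j)
  have hT : ∀ j, hsSq (T j) ≠ ⊤ := fun j ↦ hsSq_comp_right_ne_top hX _
  have hsum : ∑' j, hsSq (T j) = hsSq X := by
    rw [hsSq_eq_tsum X (a.hTmul c), ENNReal.tsum_prod', ENNReal.tsum_comm]
    refine tsum_congr fun j ↦ ?_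
    rw [hsSq_eq_tsum _ a]
    simp [T]
  have hsum' : Summable fun j ↦ (hsSq (T j)).toReal := ENNReal.summable_toReal (hsum ▸ hX)
  have hop : Summable fun j ↦ adjoint (T j) ∘L T j := by
    refine .of_norm_bounded hsum' fun j ↦ ?_
    rw [norm_adjoint_comp_self, ← sq]
    exact norm_sq_le_toReal_hsSq (hT j)
  obtain ⟨r, hr⟩ := hop
  have hr' : ∀ x x', HasSum (fun j ↦ ⟪X (hTmul x (c j)), X (hTmul x' (c j))⟫_ℂ) ⟪x, r x'⟫_ℂ := by
    intro x x'
    have h := (hr.mapL (ContinuousLinearMap.apply ℂ E x')).mapL (innerSL ℂ x)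
    simpa [adjoint_inner_right, T] using h
  -- For fixed `x, x'` the sum is the Hilbert-Schmidt inner product of `X (x ⊗ ·)` and `X (x' ⊗ ·)`,
  -- so `c` may be replaced by any basis.
  have hpt : IsPartialTraceRight ρ r := by
    intro ι b x x'
    have hK : ∀ x : E, hsSq (X ∘L tensorLeft F x) ≠ ⊤ := fun x ↦ hsSq_comp_right_ne_top hX _
    have h1 := hasSum_hsInner (hK x) (hK x') c
    have h2 := hasSum_hsInner (hK x) (hK x') b
    simp only [comp_apply, tensorLeft_apply] at h1 h2
    rw [h1.unique (hr' x x')] at h2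
    simpa only [hXρ] using h2
  refine ⟨r, ?_, hpt⟩
  have hre : ∀ x, HasSum (fun j ↦ ‖T j x‖ ^ 2) (⟪x, r x⟫_ℂ).re := fun x ↦ by
    have h := Complex.hasSum_re (hr' x x)
    exact (funext fun j ↦ norm_sq_eq_re_inner (𝕜 := ℂ) (T j x) : (fun j ↦ ‖T j x‖ ^ 2) = _) ▸ h
  have hpos : r.IsPositive := by
    rw [isPositive_iff_complex]
    intro x
    have him := Complex.hasSum_im (hr' x x)
    have him0 : (⟪x, r x⟫_ℂ).im = 0 := by
      refine him.unique ?_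
      simpa only [← RCLike.im_eq_complex_im, inner_self_im] using hasSum_zero (α := ℝ) (β := κ)
    have hre0 : 0 ≤ (⟪x, r x⟫_ℂ).re := (hre x).nonneg fun j ↦ by positivity
    have h : ⟪r x, x⟫_ℂ = ((⟪x, r x⟫_ℂ).re : ℂ) := by
      rw [← inner_conj_symm]
      apply Complex.ext
      · rw [Complex.conj_re, Complex.ofReal_re]
      · rw [Complex.conj_im, Complex.ofReal_im, him0, neg_zero]
    rw [h]
    exact ⟨by simp, by simpa using hre0⟩
  rw [hpos.isPosTraceClass_iff a]
  -- The diagonal of `r`, summed over `a`, is the double sum defining `hsSq X`, which is finite.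
  have h1 : ∀ i, ENNReal.ofReal (⟪a i, r (a i)⟫_ℂ).re = ∑' j, ‖X (a.hTmul c (i, j))‖ₑ ^ 2 := by
    intro i
    rw [← (hre (a i)).tsum_eq,
      ENNReal.ofReal_tsum_of_nonneg (fun _ ↦ by positivity) (hre _).summable]
    refine tsum_congr fun j ↦ ?_
    rw [← enorm_sq_eq_ofReal]
    simp [T]
  have h2 : ∑' i, ENNReal.ofReal (⟪a i, r (a i)⟫_ℂ).re ≠ ⊤ := by
    simp_rw [h1]
    rwa [← ENNReal.tsum_prod' (f := fun p ↦ ‖X (a.hTmul c p)‖ₑ ^ 2),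
      ← hsSq_eq_tsum X (a.hTmul c)]
  exact (ENNReal.summable_toReal h2).congr fun i ↦
    ENNReal.toReal_ofReal (hpos.re_inner_nonneg_right _)

theorem LinearIsometryEquiv.adjoint_toCLM (U : E ≃ₗᵢ[ℂ] F) :
    adjoint U.toContinuousLinearEquiv.toContinuousLinearMap =
      U.symm.toContinuousLinearEquiv.toContinuousLinearMap := by
  ext x
  refine ext_inner_left ℂ fun y ↦ ?_
  rw [adjoint_inner_right]
  simpa using (U.inner_map_map y (U.symm x))

/-- The operator `U T U⁻¹`. -/
noncomputable def unitaryConj (U : E ≃ₗᵢ[ℂ] F) : (E →L[ℂ] E) →L[ℂ] (F →L[ℂ] F) :=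
  (compL ℂ F E F U.toContinuousLinearEquiv.toContinuousLinearMap) ∘L
    ((compL ℂ F E E).flip U.symm.toContinuousLinearEquiv.toContinuousLinearMap)

omit [CompleteSpace F] in
@[simp]
theorem unitaryConj_apply (U : E ≃ₗᵢ[ℂ] F) (T : E →L[ℂ] E) (x : F) :
    unitaryConj U T x = U (T (U.symm x)) := rfl

omit [CompleteSpace F] in
theorem inner_unitaryConj (U : E ≃ₗᵢ[ℂ] F) (T : E →L[ℂ] E) (x y : E) :
    ⟪U x, unitaryConj U T (U y)⟫_ℂ = ⟪x, T y⟫_ℂ := by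
  simp

theorem IsPosTraceClass.unitaryConj {T : E →L[ℂ] E} (hT : IsPosTraceClass T) (U : E ≃ₗᵢ[ℂ] F) :
    IsPosTraceClass (unitaryConj U T) := by
  have h := hT.conj U.symm.toContinuousLinearEquiv.toContinuousLinearMap
  rwa [LinearIsometryEquiv.adjoint_toCLM] at h

theorem IsPosTraceClass.exists_isPartialTraceLeft
    {ρ : HilbertTensor E F →L[ℂ] HilbertTensor E F} (hρ : IsPosTraceClass ρ) :
    ∃ r, IsPosTraceClass r ∧ IsPartialTraceLeft ρ r := by
  obtain ⟨U, hU⟩ := exists_comm_hTmul (E := E) (F := F)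
  obtain ⟨r, hr, h⟩ := (hρ.unitaryConj U).exists_isPartialTraceRight
  refine ⟨r, hr, fun ι b y y' ↦ ?_⟩
  have h' := h ι b y y'
  simp_rw [← hU, inner_unitaryConj] at h'
  exact h'

/-- The projection onto a unit vector works; its trace is one by Parseval. -/
theorem exists_isDensityOperator [Nontrivial E] : ∃ σ : E →L[ℂ] E, IsDensityOperator σ := by
  obtain ⟨v, hv⟩ := exists_norm_eq E zero_le_one
  have hpos : (ketBra v v).IsPositive := InnerProductSpace.isPositive_rankOne_self v
  have hin : ∀ x, ⟪x, ketBra v v x⟫_ℂ = ((‖⟪x, v⟫_ℂ‖ ^ 2 : ℝ) : ℂ) := fun x ↦ by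
    simp only [ketBra, InnerProductSpace.rankOne_apply, inner_smul_right]
    rw [← inner_conj_symm v x, ← Complex.normSq_eq_conj_mul_self, Complex.normSq_eq_norm_sq]
  have htr : HasTrace (ketBra v v) 1 := fun ι b ↦ by
    simp_rw [hin]
    simpa [hv] using Complex.hasSum_ofReal.2 (b.hasSum_norm_inner_sq v)
  refine ⟨ketBra v v, hpos, IsPosTraceClass.isTraceClass ?_, htr⟩
  obtain ⟨_, b, -⟩ := exists_hilbertBasis ℂ E
  exact (hpos.isPosTraceClass_iff b).2 (Complex.hasSum_re (htr _ b)).summable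

end PartialTrace

/-! ### Assembling the source-operators -/

section SourceOperator

theorem HasSum.congr_eq {ι M : Type*} [AddCommMonoid M] [TopologicalSpace M] {f g : ι → M} {s : M}
    (h : HasSum f s) (hgf : ∀ i, g i = f i) : HasSum g s :=
  (funext hgf : g = f) ▸ h

variable {E F : Type*} [NormedAddCommGroup E] [InnerProductSpace ℂ E]
  [NormedAddCommGroup F] [InnerProductSpace ℂ F] [CompleteSpace E] [CompleteSpace F]

omit [CompleteSpace E] [CompleteSpace F] in
theorem hTmul_ext₃ {G M : Type*} [NormedAddCommGroup G] [InnerProductSpace ℂ G]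
    [NormedAddCommGroup M] [NormedSpace ℂ M]
    {f g : HilbertTensor (HilbertTensor E F) G →L[ℂ] M}
    (h : ∀ x y z, f (hTmul (hTmul x y) z) = g (hTmul (hTmul x y) z)) : f = g :=
  hTmul_ext fun v z ↦ congrArg (fun k : HilbertTensor E F →L[ℂ] M ↦ k v)
    (hTmul_ext (f := f ∘L tensorRight _ z) (g := g ∘L tensorRight _ z) fun x y ↦ h x y z)

omit [CompleteSpace F] in
theorem inner_unitaryConj_symm (U : E ≃ₗᵢ[ℂ] F) (T : E →L[ℂ] E) (x y : F) :
    ⟪x, unitaryConj U T y⟫_ℂ = ⟪U.symm x, T (U.symm y)⟫_ℂ := by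
  rw [unitaryConj_apply, ← U.symm.inner_map_map, U.symm_apply_apply]

/-- Splitting `T = P - N` regroups the expression as `(A + B + P) - (C + N)`, a difference of
positive trace class operators. -/
theorem isTraceClass_source {A B C T : E →L[ℂ] E} (hA : IsPosTraceClass A)
    (hB : IsPosTraceClass B) (hC : IsPosTraceClass C) (hT : IsTraceClass T)
    (hsa : IsSelfAdjoint T) : IsTraceClass (A + B - C + T) := by
  obtain ⟨P, N, hP, hN, rfl⟩ := hT.exists_eq_sub hsa
  convert isTraceClass_sub ((hA.add hB).add hP) (hC.add hN) using 1
  abel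

theorem isSelfAdjoint_source {A B C T : E →L[ℂ] E} (hA : IsPosTraceClass A)
    (hB : IsPosTraceClass B) (hC : IsPosTraceClass C) (hsa : IsSelfAdjoint T) :
    IsSelfAdjoint (A + B - C + T) :=
  ((hA.isPositive.isSelfAdjoint.add hB.isPositive.isSelfAdjoint).sub
    hC.isPositive.isSelfAdjoint).add hsa

theorem exists_isSourceOperator₁₂₂ {ι : Type*} {ρ : HilbertTensor E F →L[ℂ] HilbertTensor E F}
    (hρ : IsDensityOperator ρ) (φ : HilbertBasis ι ℂ F) {σ : F →L[ℂ] F}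
    (hσ : IsDensityOperator σ)
    {τ : HilbertTensor (HilbertTensor E F) F →L[ℂ] HilbertTensor (HilbertTensor E F) F}
    (hsa : IsSelfAdjoint τ) (htc : IsTraceClass τ) (h2 : IsPartialTraceSecond τ 0)
    (h3 : IsPartialTraceThird τ 0) :
    ∃ A B r,
      HasSum (fun p : ι × ι =>
        opTensor (blockRight ρ (φ p.1) (φ p.2)) (ketBra (φ p.1) (φ p.2))) ρ ∧
      HasSum (fun p : ι × ι =>
        opTensor (opTensor (blockRight ρ (φ p.1) (φ p.2)) (ketBra (φ p.1) (φ p.2))) σ) A ∧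
      HasSum (fun p : ι × ι =>
        opTensor (opTensor (blockRight ρ (φ p.1) (φ p.2)) σ) (ketBra (φ p.1) (φ p.2))) B ∧
      IsPartialTraceRight ρ r ∧
      IsSourceOperator₁₂₂ ρ (A + B - opTensor (opTensor r σ) σ + τ) := by
  have hρ' := hρ.isPosTraceClass
  have hσ' := hσ.isPosTraceClass
  obtain ⟨r, hr, hρr⟩ := hρ'.exists_isPartialTraceRight
  obtain ⟨U, hU⟩ := exists_swap_hTmul (E := E) (F := F) (G := F)
  have hA := hρ'.opTensor hσ'
  have hB := hA.unitaryConj U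
  have hC := (hr.opTensor hσ').opTensor hσ'
  have hblock := hasSum_blockRight hρ'.hsSq_ne_top φ
  have hU' : ∀ x y z, U.symm (hTmul (hTmul x y) z) = hTmul (hTmul x z) y := fun x y z ↦ by
    rw [LinearIsometryEquiv.symm_apply_eq, hU]
  have hsumA := hblock.mapL (opTensorFlip _ σ)
  have hsumB := hsumA.mapL (unitaryConj U)
  refine ⟨opTensor ρ σ, unitaryConj U (opTensor ρ σ), r, hblock, hsumA, ?_, hρr,
    isSelfAdjoint_source hA hB hC hsa, isTraceClass_source hA hB hC htc hsa, ?_, ?_⟩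
  · refine hsumB.congr_eq fun p ↦ hTmul_ext₃ fun x y z ↦ ?_
    simp [hU, hU']
  -- Over the second place, `A` gives `r ⊗ σ`, cancelled by the correction term, while `B` gives ρ.
  -- Over the third place the roles of `A` and `B` are exchanged.
  · intro κ b x x' z z'
    have hA2 := (hρr κ b x x').mul_right ⟪z, σ z'⟫_ℂ
    have hB2 := (hσ.hasTrace_one κ b).mul_left ⟪hTmul x z, ρ (hTmul x' z')⟫_ℂ
    have hC2 := ((hσ.hasTrace_one κ b).mul_left ⟪x, r x'⟫_ℂ).mul_right ⟪z, σ z'⟫_ℂ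
    have h := ((hA2.add hB2).sub hC2).add (h2 κ b x x' z z')
    simp only [mul_one, add_sub_cancel_left, zero_apply, inner_zero_right, add_zero] at h
    refine h.congr_eq fun i ↦ ?_
    simp only [add_apply, sub_apply, inner_add_right, inner_sub_right, inner_unitaryConj_symm, hU',
      opTensor_hTmul, inner_hTmul]
  · intro κ b x x' y y'
    have hA3 := (hσ.hasTrace_one κ b).mul_left ⟪hTmul x y, ρ (hTmul x' y')⟫_ℂ
    have hB3 := (hρr κ b x x').mul_right ⟪y, σ y'⟫_ℂ
    have hC3 := (hσ.hasTrace_one κ b).mul_left (⟪x, r x'⟫_ℂ * ⟪y, σ y'⟫_ℂ)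
    have h := ((hA3.add hB3).sub hC3).add (h3 κ b x x' y y')
    simp only [mul_one, add_sub_cancel_right, zero_apply, inner_zero_right, add_zero] at h
    refine h.congr_eq fun i ↦ ?_
    simp only [add_apply, sub_apply, inner_add_right, inner_sub_right, inner_unitaryConj_symm, hU',
      opTensor_hTmul, inner_hTmul]

theorem exists_isSourceOperator₁₁₂ {ι : Type*} {ρ : HilbertTensor E F →L[ℂ] HilbertTensor E F}
    (hρ : IsDensityOperator ρ) (e : HilbertBasis ι ℂ E) {σ : E →L[ℂ] E}
    (hσ : IsDensityOperator σ)
    {τ : HilbertTensor (HilbertTensor E E) F →L[ℂ] HilbertTensor (HilbertTensor E E) F}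
    (hsa : IsSelfAdjoint τ) (htc : IsTraceClass τ) (h1 : IsPartialTraceFirst τ 0)
    (h2 : IsPartialTraceSecond τ 0) :
    ∃ A B r,
      HasSum (fun p : ι × ι =>
        opTensor (ketBra (e p.1) (e p.2)) (blockLeft ρ (e p.1) (e p.2))) ρ ∧
      HasSum (fun p : ι × ι =>
        opTensor (opTensor σ (ketBra (e p.1) (e p.2))) (blockLeft ρ (e p.1) (e p.2))) A ∧
      HasSum (fun p : ι × ι =>
        opTensor (opTensor (ketBra (e p.1) (e p.2)) σ) (blockLeft ρ (e p.1) (e p.2))) B ∧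
      IsPartialTraceLeft ρ r ∧
      IsSourceOperator₁₁₂ ρ (A + B - opTensor (opTensor σ σ) r + τ) := by
  have hρ' := hρ.isPosTraceClass
  have hσ' := hσ.isPosTraceClass
  obtain ⟨r, hr, hρr⟩ := hρ'.exists_isPartialTraceLeft
  -- Both terms come from ρ ⊗ σ on H₁ ⊗ H₂ ⊗ H₁: `R` moves the last factor to the front, `U` moves
  -- it to the middle.
  obtain ⟨R, hR⟩ := exists_rotate_hTmul (E := E) (F := F) (G := E)
  obtain ⟨U, hU⟩ := exists_swap_hTmul (E := E) (F := F) (G := E)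
  have hR' : ∀ x y z, R.symm (hTmul (hTmul x y) z) = hTmul (hTmul y z) x := fun x y z ↦ by
    rw [LinearIsometryEquiv.symm_apply_eq, hR]
  have hU' : ∀ x y z, U.symm (hTmul (hTmul x y) z) = hTmul (hTmul x z) y := fun x y z ↦ by
    rw [LinearIsometryEquiv.symm_apply_eq, hU]
  have hρσ := hρ'.opTensor hσ'
  have hA := hρσ.unitaryConj R
  have hB := hρσ.unitaryConj U
  have hC := (hσ'.opTensor hσ').opTensor hr
  have hblock := hasSum_blockLeft hρ'.hsSq_ne_top e
  have hsum := hblock.mapL (opTensorFlip _ σ)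
  refine ⟨unitaryConj R (opTensor ρ σ), unitaryConj U (opTensor ρ σ), r, hblock,
    (hsum.mapL (unitaryConj R)).congr_eq fun p ↦ hTmul_ext₃ fun x y z ↦ ?_,
    (hsum.mapL (unitaryConj U)).congr_eq fun p ↦ hTmul_ext₃ fun x y z ↦ ?_, hρr,
    isSelfAdjoint_source hA hB hC hsa, isTraceClass_source hA hB hC htc hsa, ?_, ?_⟩
  · simp [hR, hR']
  · simp [hU, hU']
  · intro κ b y y' z z'
    have hA1 := (hσ.hasTrace_one κ b).mul_left ⟪hTmul y z, ρ (hTmul y' z')⟫_ℂ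
    have hB1 := (hρr κ b z z').mul_right ⟪y, σ y'⟫_ℂ
    have hC1 := ((hσ.hasTrace_one κ b).mul_right ⟪y, σ y'⟫_ℂ).mul_right ⟪z, r z'⟫_ℂ
    have h := ((hA1.add hB1).sub hC1).add (h1 κ b y y' z z')
    simp only [mul_one, one_mul, mul_comm ⟪y, σ y'⟫_ℂ ⟪z, r z'⟫_ℂ, add_sub_cancel_right,
      zero_apply, inner_zero_right, add_zero] at h
    refine h.congr_eq fun i ↦ ?_
    simp only [add_apply, sub_apply, inner_add_right, inner_sub_right, inner_unitaryConj_symm, hU',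
      hR', opTensor_hTmul, inner_hTmul]
  · intro κ b x x' z z'
    have hA2 := (hρr κ b z z').mul_right ⟪x, σ x'⟫_ℂ
    have hB2 := (hσ.hasTrace_one κ b).mul_left ⟪hTmul x z, ρ (hTmul x' z')⟫_ℂ
    have hC2 := ((hσ.hasTrace_one κ b).mul_left ⟪x, σ x'⟫_ℂ).mul_right ⟪z, r z'⟫_ℂ
    have h := ((hA2.add hB2).sub hC2).add (h2 κ b x x' z z')
    simp only [mul_one, mul_comm ⟪x, σ x'⟫_ℂ ⟪z, r z'⟫_ℂ, add_sub_cancel_left,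
      zero_apply, inner_zero_right, add_zero] at h
    refine h.congr_eq fun i ↦ ?_
    simp only [add_apply, sub_apply, inner_add_right, inner_sub_right, inner_unitaryConj_symm, hU',
      hR', opTensor_hTmul, inner_hTmul]

-- If a factor were zero, every product vector would vanish and ρ would be zero, contradicting trace
-- one. Nontriviality is what provides a density operator σ on each factor.
omit [CompleteSpace E] [CompleteSpace F] in
theorem IsDensityOperator.nontrivial_factors
    {ρ : HilbertTensor E F →L[ℂ] HilbertTensor E F} (hρ : IsDensityOperator ρ) :
    Nontrivial E ∧ Nontrivial F := by
  obtain ⟨_, b, -⟩ := exists_hilbertBasis ℂ (HilbertTensor E F)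
  have hρ0 : ρ ≠ 0 := by
    rintro rfl
    have h := (hρ.hasTrace_one _ b).unique (a₂ := 0) (by simp)
    exact one_ne_zero h
  constructor <;>
  · by_contra h
    rw [not_nontrivial_iff_subsingleton] at h
    refine hρ0 (hTmul_ext fun x y ↦ ?_)
    first
    | rw [Subsingleton.elim x 0]
      exact congrArg ρ ((tensorRight E y).map_zero)|>.trans (map_zero ρ)
    | rw [Subsingleton.elim y 0]
      exact congrArg ρ ((tensorLeft F x).map_zero)|>.trans (map_zero ρ)

theorem isSelfAdjoint_zero : IsSelfAdjoint (0 : E →L[ℂ] E) := .zero _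

theorem isTraceClass_zero : IsTraceClass (0 : E →L[ℂ] E) := fun ι b ↦ by
  simp

end SourceOperator

end

theorem proposition1 {H₁ : Type u₁} {H₂ : Type u₂}
    [NormedAddCommGroup H₁] [InnerProductSpace ℂ H₁] [CompleteSpace H₁]
    [NormedAddCommGroup H₂] [InnerProductSpace ℂ H₂] [CompleteSpace H₂]
    (ρ : HilbertTensor H₁ H₂ →L[ℂ] HilbertTensor H₁ H₂) (hρ : IsDensityOperator ρ) :
    (∃ T₁₂₂, IsSourceOperator₁₂₂ ρ T₁₂₂) ∧
    (∃ T₁₁₂, IsSourceOperator₁₁₂ ρ T₁₁₂) ∧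
    (∀ {ι : Type w} (φ : HilbertBasis ι ℂ H₂) (σ : H₂ →L[ℂ] H₂), IsDensityOperator σ →
      ∀ τ : HilbertTensor (HilbertTensor H₁ H₂) H₂ →L[ℂ] HilbertTensor (HilbertTensor H₁ H₂) H₂,
        IsSelfAdjoint τ → IsTraceClass τ → IsPartialTraceSecond τ 0 → IsPartialTraceThird τ 0 →
      ∃ A B r,
        HasSum (fun p : ι × ι =>
          opTensor (blockRight ρ (φ p.1) (φ p.2)) (ketBra (φ p.1) (φ p.2))) ρ ∧
        HasSum (fun p : ι × ι =>
          opTensor (opTensor (blockRight ρ (φ p.1) (φ p.2)) (ketBra (φ p.1) (φ p.2))) σ) A ∧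
        HasSum (fun p : ι × ι =>
          opTensor (opTensor (blockRight ρ (φ p.1) (φ p.2)) σ) (ketBra (φ p.1) (φ p.2))) B ∧
        IsPartialTraceRight ρ r ∧
        IsSourceOperator₁₂₂ ρ (A + B - opTensor (opTensor r σ) σ + τ)) ∧
    (∀ {ι : Type w} (e : HilbertBasis ι ℂ H₁) (σ : H₁ →L[ℂ] H₁), IsDensityOperator σ →
      ∀ τ : HilbertTensor (HilbertTensor H₁ H₁) H₂ →L[ℂ] HilbertTensor (HilbertTensor H₁ H₁) H₂,
        IsSelfAdjoint τ → IsTraceClass τ → IsPartialTraceFirst τ 0 → IsPartialTraceSecond τ 0 →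
      ∃ A B r,
        HasSum (fun p : ι × ι =>
          opTensor (ketBra (e p.1) (e p.2)) (blockLeft ρ (e p.1) (e p.2))) ρ ∧
        HasSum (fun p : ι × ι =>
          opTensor (opTensor σ (ketBra (e p.1) (e p.2))) (blockLeft ρ (e p.1) (e p.2))) A ∧
        HasSum (fun p : ι × ι =>
          opTensor (opTensor (ketBra (e p.1) (e p.2)) σ) (blockLeft ρ (e p.1) (e p.2))) B ∧
        IsPartialTraceLeft ρ r ∧
        IsSourceOperator₁₁₂ ρ (A + B - opTensor (opTensor σ σ) r + τ)) := by
  refine ⟨?_, ?_, fun φ σ hσ τ hsa htc h2 h3 ↦ exists_isSourceOperator₁₂₂ hρ φ hσ hsa htc h2 h3,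
    fun e σ hσ τ hsa htc h1 h2 ↦ exists_isSourceOperator₁₁₂ hρ e hσ hsa htc h1 h2⟩
  -- Existence is the explicit formula with τ = 0 and some density operator σ.
  · have := hρ.nontrivial_factors.2
    obtain ⟨σ, hσ⟩ := exists_isDensityOperator (E := H₂)
    obtain ⟨_, φ, -⟩ := exists_hilbertBasis ℂ H₂
    obtain ⟨A, B, r, -, -, -, -, h⟩ := exists_isSourceOperator₁₂₂ hρ φ hσ isSelfAdjoint_zero
      isTraceClass_zero (fun _ _ _ _ _ _ ↦ by simp)
      (fun _ _ _ _ _ _ ↦ by simp)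
    exact ⟨_, h⟩
  · have := hρ.nontrivial_factors.1
    obtain ⟨σ, hσ⟩ := exists_isDensityOperator (E := H₁)
    obtain ⟨_, e, -⟩ := exists_hilbertBasis ℂ H₁
    obtain ⟨A, B, r, -, -, -, -, h⟩ := exists_isSourceOperator₁₁₂ hρ e hσ isSelfAdjoint_zero
      isTraceClass_zero (fun _ _ _ _ _ _ ↦ by simp)
      (fun _ _ _ _ _ _ ↦ by simp)
    exact ⟨_, h⟩
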